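/- Let $(C,g)$ be a compact connected Riemann surface with a smooth Hermitian metric $g$ and volume form $dV_g$. Let $\{(U_j,\varphi_j)\}$ be a finite covering of $C$ by open sets with biholomorphic coordinates $\varphi_j\colon U_j\to\mathbb D=\{|z|<1\}$, put $U_j^r=\varphi_j^{-1}(\{|z|<r\})$, and let $r_*\in(0,1)$ be such that $\mathcal U^r=\{U_j^r\}$ covers $C$ for every $r\in[r_*,1]$. For a holomorphic line bundle $L$ on $C$ with smooth Hermitian metric $h$, a \v{C}ech $0$-cochain $u=\{u_j\}\in\check C^0(\mathcal U^r,\mathcal O_C(L))$ and a $1$-cochain $f=\{f_{jk}\}\in\check C^1(\mathcal U^r,\mathcal O_C(L))$, put $(\delta u)_{jk}=u_k-u_j$ on $U_j^r\cap U_k^r$ and $$\|u\|_{L^2,\mathcal U^r}=\max_j\Big(\int_{U_j^r}|u_j|_h^2\,dV_g\Big)^{1/2},\qquad \|f\|_{L^2,\mathcal U^r}=\max_{j,k}\Big(\int_{U_j^r\cap U_k^r}|f_{jk}|_h^2\,dV_g\Big)^{1/2}$$ (values in $[0,\infty]$). Let $\check B^1(\mathcal U^r,L)$ be the image of $\delta$.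 Let $K_{\mathrm{H\ddot o}}(L)\in[0,\infty]$ be the infimum of the constants $c>0$ such that every smooth $\bar\partial$-closed $L$-valued $(0,1)$-form $v$ with trivial class in $H^{0,1}(C,L)$ is of the form $v=\bar\partial\eta$ for some smooth global section $\eta$ of $L$ with $$\Big(\int_C|\eta|_h^2\,dV_g\Big)^{1/2}\le c\,\Big(\int_C|v|_{g,h}^2\,dV_g\Big)^{1/2}.$$ Then there exist constants $\alpha,\beta>0$, depending only on $(C,g)$, on the covering $\{(U_j,\varphi_j)\}$ and on $r_*$, such that for every Hermitian holomorphic line bundle $(L,h)$ on $C$, every $r\in[r_*,1]$ and every $f\in\check B^1(\mathcal U^r,L)$ there exists $u\in\check C^0(\mathcal U^r,\mathcal O_C(L))$ with $\delta u=f$ and $$\|u\|_{L^2,\mathcal U^r}\le\big(\alpha+\beta K_{\mathrm{H\ddot o}}(L)\big)\,\|f\|_{L^2,\mathcal U^r}.$$ -/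

import Mathlib

open scoped Manifold ContDiff ENNReal NNReal Bundle
open Bundle MeasureTheory

namespace RiemannSurface

noncomputable section

/-- A smooth Hermitian metric on a holomorphic line bundle `E` over a complex curve `C`: a positive
definite Hermitian form on every fibre such that the squared length of each of the distinguished
local holomorphic frames (the image of `1` under a local trivialization) is a `C^∞` function.
It is also used for `E` the holomorphic tangent bundle, where it is a Hermitian metric on `C`. -/
structure HermitianMetric {C : Type*} [TopologicalSpace C] [ChartedSpace ℂ C]
    (E : C → Type*) [∀ x, AddCommGroup (E x)] [∀ x, Module ℂ (E x)]
    [∀ x, TopologicalSpace (E x)] [TopologicalSpace (TotalSpace ℂ E)]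
    [FiberBundle ℂ E] [VectorBundle ℂ ℂ E] where
  /-- The Hermitian form on the fibre, conjugate-linear in the first variable. -/
  form : ∀ x, E x →ₗ⋆[ℂ] E x →ₗ[ℂ] ℂ
  conj_symm : ∀ x (v w : E x), form x v w = starRingEnd ℂ (form x w v)
  pos_def : ∀ x (v : E x), v ≠ 0 → 0 < (form x v v).re
  smooth : ∀ x₀ : C, ContMDiffOn 𝓘(ℝ, ℂ) 𝓘(ℝ, ℝ) ∞
    (fun y => (form y ((trivializationAt ℂ E x₀).symm y 1)
      ((trivializationAt ℂ E x₀).symm y 1)).re)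
    (trivializationAt ℂ E x₀).baseSet

section Bundle

variable {C : Type*} [TopologicalSpace C] [ChartedSpace ℂ C]
  {E : C → Type*} [∀ x, AddCommGroup (E x)] [∀ x, Module ℂ (E x)]
  [∀ x, TopologicalSpace (E x)] [TopologicalSpace (TotalSpace ℂ E)]
  [FiberBundle ℂ E] [VectorBundle ℂ ℂ E]

/-- The squared length `|v|_h²` of a vector of a fibre. -/
def HermitianMetric.normSq (h : HermitianMetric E) (x : C) (v : E x) : ℝ := (h.form x v v).re

/-- The section `s` is holomorphic on the set `U` (used for open `U`). -/
def IsHolomorphicOn (s : ∀ x, E x) (U : Set C) : Prop :=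
  MDifferentiableOn 𝓘(ℂ, ℂ) (𝓘(ℂ, ℂ).prod 𝓘(ℂ, ℂ)) (fun x => TotalSpace.mk' ℂ x (s x)) U

/-- The global section `s` is of class `C^∞` in the real sense. -/
def IsSmoothSection (s : ∀ x, E x) : Prop :=
  ContMDiff 𝓘(ℝ, ℂ) (𝓘(ℝ, ℂ).prod 𝓘(ℝ, ℂ)) ∞ (fun x => TotalSpace.mk' ℂ x (s x))

/-- The real differential at `x` of a complex-valued function `f` on `C`, as an additive map on the
(holomorphic) tangent space at `x`, which is the same set as the real tangent space. -/
def realDiff (f : C → ℂ) (x : C) : TangentSpace 𝓘(ℂ, ℂ) x → ℂ :=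
  fun ξ => (mfderiv 𝓘(ℝ, ℂ) 𝓘(ℝ, ℂ) f x : ℂ →L[ℝ] ℂ) ξ

theorem realDiff_add (f : C → ℂ) (x : C) (ξ η : TangentSpace 𝓘(ℂ, ℂ) x) :
    realDiff f x (ξ + η) = realDiff f x ξ + realDiff f x η :=
  (mfderiv 𝓘(ℝ, ℂ) 𝓘(ℝ, ℂ) f x : ℂ →L[ℝ] ℂ).map_add ξ η

theorem realDiff_ofReal_smul (f : C → ℂ) (x : C) (a : ℝ) (ξ : TangentSpace 𝓘(ℂ, ℂ) x) :
    realDiff f x ((a : ℂ) • ξ) = a * realDiff f x ξ := by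
  have := (mfderiv 𝓘(ℝ, ℂ) 𝓘(ℝ, ℂ) f x : ℂ →L[ℝ] ℂ).map_smul a ξ
  exact this.trans (Complex.real_smul ..)

/-- The conjugate-linear part `ξ ↦ (df(ξ) + i df(iξ)) / 2` of the real differential of `f` at `x`,
that is, the value of `∂̄f` at `x`. -/
def dbarFun (f : C → ℂ) (x : C) : TangentSpace 𝓘(ℂ, ℂ) x →ₗ⋆[ℂ] ℂ where
  toFun ξ := (realDiff f x ξ + Complex.I * realDiff f x (Complex.I • ξ)) / 2
  map_add' ξ η := by
    rw [smul_add, realDiff_add, realDiff_add]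
    ring
  map_smul' c ξ := by
    have key : ∀ ζ : TangentSpace 𝓘(ℂ, ℂ) x, realDiff f x (c • ζ)
        = c.re * realDiff f x ζ + c.im * realDiff f x (Complex.I • ζ) := by
      intro ζ
      rw [← realDiff_ofReal_smul, ← realDiff_ofReal_smul, ← realDiff_add, smul_smul, ← add_smul,
        Complex.re_add_im]
    have hI : realDiff f x (Complex.I • Complex.I • ξ) = - realDiff f x ξ := by
      have := realDiff_ofReal_smul f x (-1) ξ
      rw [smul_smul, Complex.I_mul_I]
      simpa using this
    rw [smul_comm Complex.I c ξ, key, key, hI]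
    have hc : starRingEnd ℂ c = c.re - c.im * Complex.I := by
      apply Complex.ext <;> simp
    rw [hc, smul_eq_mul]
    linear_combination ((c.im : ℂ) * realDiff f x (Complex.I • ξ) / 2) * Complex.I_sq

variable (E) in
/-- An `E`-valued `(0,1)`-form on `C` (with no regularity): at every point a conjugate-linear map
from the tangent space to the fibre of `E`. -/
abbrev ZeroOneForm : Type _ := ∀ x : C, TangentSpace 𝓘(ℂ, ℂ) x →ₗ⋆[ℂ] E x

/-- The Dolbeault operator on sections of a holomorphic line bundle: in a local holomorphic
trivialization around `x` the section is a function, whose `∂̄` is transported back to `E x`. -/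
def dbar (s : ∀ x, E x) : ZeroOneForm E := fun x =>
  ((trivializationAt ℂ E x).symmₗ ℂ x).comp
    (dbarFun (fun y => ((trivializationAt ℂ E x) (TotalSpace.mk' ℂ y (s y))).2) x)

/-- `v` is a smooth `∂̄`-closed `(0,1)`-form whose class in the Dolbeault cohomology group
`H^{0,1}(C, E)` vanishes, that is, `v = ∂̄w` for a global `C^∞` section `w` of `E`.  (Such a `v` is
automatically of class `C^∞`, and on a curve every `(0,1)`-form is `∂̄`-closed.) -/
def IsDolbeaultTrivial (v : ZeroOneForm E) : Prop :=
  ∃ w : ∀ x, E x, IsSmoothSection w ∧ dbar w = v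

end Bundle

section Metric

variable {C : Type*} [TopologicalSpace C] [ChartedSpace ℂ C] [IsManifold 𝓘(ℂ, ℂ) ω C]

/-- The density `λ` of the Hermitian metric `g` in a holomorphic coordinate `φ`: the squared
`g`-length of the coordinate vector field at the point with coordinate `z`, so that
`g = λ |dz|²` and `dV_g = λ dx dy`. -/
def density (g : HermitianMetric (TangentSpace 𝓘(ℂ, ℂ) : C → Type _))
    (φ : OpenPartialHomeomorph C ℂ) (z : ℂ) : ℝ :=
  g.normSq (φ.symm z) (mfderiv 𝓘(ℂ, ℂ) 𝓘(ℂ, ℂ) φ.symm z (1 : ℂ))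

variable [MeasurableSpace C]

/-- The measure `λ dx dy` carried by the domain of a holomorphic coordinate `φ`. -/
def chartVolume (g : HermitianMetric (TangentSpace 𝓘(ℂ, ℂ) : C → Type _))
    (φ : OpenPartialHomeomorph C ℂ) : Measure C :=
  (((volume : Measure ℂ).restrict φ.target).withDensity
    (fun z => ENNReal.ofReal (density g φ z))).map φ.symm

/-- The volume measure `dV_g`: the least measure on `C` that dominates `λ dx dy` on the domain of
every holomorphic coordinate.  As these measures agree on overlaps, it restricts to `λ dx dy` on
each coordinate domain. -/
def volumeMeasure (g : HermitianMetric (TangentSpace 𝓘(ℂ, ℂ) : C → Type _)) : Measure C :=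
  ⨆ φ ∈ IsManifold.maximalAtlas 𝓘(ℂ, ℂ) ω C, chartVolume g φ

variable {E : C → Type*} [∀ x, AddCommGroup (E x)] [∀ x, Module ℂ (E x)]
  [∀ x, TopologicalSpace (E x)] [TopologicalSpace (TotalSpace ℂ E)]
  [FiberBundle ℂ E] [VectorBundle ℂ ℂ E]

/-- The `L²`-norm `(∫_A |s|_h² dV_g)^{1/2}`, possibly infinite, of a section over a set `A`. -/
def l2Norm (g : HermitianMetric (TangentSpace 𝓘(ℂ, ℂ) : C → Type _)) (h : HermitianMetric E)
    (A : Set C) (s : ∀ x, E x) : ℝ≥0∞ :=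
  (∫⁻ x in A, ENNReal.ofReal (h.normSq x (s x)) ∂(volumeMeasure g)) ^ (1 / 2 : ℝ)

/-- The squared pointwise norm `|v|_{g,h}²` of an `E`-valued `(0,1)`-form at `x`: the supremum of
`|v(ξ)|_h²` over the tangent vectors with `|ξ|_g ≤ 1`. -/
def formNormSq (g : HermitianMetric (TangentSpace 𝓘(ℂ, ℂ) : C → Type _)) (h : HermitianMetric E)
    (v : ZeroOneForm E) (x : C) : ℝ≥0∞ :=
  ⨆ ξ : TangentSpace 𝓘(ℂ, ℂ) x, ⨆ _ : g.normSq x ξ ≤ 1, ENNReal.ofReal (h.normSq x (v x ξ))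

/-- The `L²`-norm `(∫_C |v|_{g,h}² dV_g)^{1/2}` of an `E`-valued `(0,1)`-form. -/
def l2NormForm (g : HermitianMetric (TangentSpace 𝓘(ℂ, ℂ) : C → Type _)) (h : HermitianMetric E)
    (v : ZeroOneForm E) : ℝ≥0∞ :=
  (∫⁻ x, formNormSq g h v x ∂(volumeMeasure g)) ^ (1 / 2 : ℝ)

/-- The constant `c` is admissible in Hörmander's estimate for `(E, h)` on `(C, g)`: every smooth
`E`-valued `∂̄`-closed `(0,1)`-form `v` with trivial Dolbeault class is `∂̄u` for a smooth global
section `u` with `‖u‖_{L²} ≤ c ‖v‖_{L²}`. -/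
def IsHormanderConstant (g : HermitianMetric (TangentSpace 𝓘(ℂ, ℂ) : C → Type _))
    (h : HermitianMetric E) (c : ℝ≥0) : Prop :=
  ∀ v : ZeroOneForm E, IsDolbeaultTrivial v →
    ∃ u : ∀ x, E x, IsSmoothSection u ∧ dbar u = v ∧
      l2Norm g h Set.univ u ≤ c * l2NormForm g h v

/-- The Hörmander constant `K_Hö(E)`: the infimum, in `[0, ∞]`, of the positive admissible
constants. -/
def hormanderConstant (g : HermitianMetric (TangentSpace 𝓘(ℂ, ℂ) : C → Type _))
    (h : HermitianMetric E) : ℝ≥0∞ :=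
  ⨅ (c : ℝ≥0) (_ : 0 < c ∧ IsHormanderConstant g h c), (c : ℝ≥0∞)

end Metric

/-- A finite covering of `C` by holomorphic coordinate discs `φ_j : U_j ≅ 𝔻`, with a radius
`r_* ∈ (0, 1)` such that for all `r ∈ [r_*, 1]` the nested sets `U_j^r = φ_j⁻¹(𝔻_r)` still
cover `C`. -/
structure NestedCovering (C : Type*) [TopologicalSpace C] [ChartedSpace ℂ C]
    (ι : Type*) where
  chart : ι → OpenPartialHomeomorph C ℂ
  chart_mem : ∀ j, chart j ∈ IsManifold.maximalAtlas 𝓘(ℂ, ℂ) ω C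
  target_eq : ∀ j, (chart j).target = Metric.ball 0 1
  rStar : ℝ
  rStar_pos : 0 < rStar
  rStar_lt_one : rStar < 1
  covers : ∀ r ∈ Set.Icc rStar 1,
    (⋃ j, (chart j).source ∩ chart j ⁻¹' Metric.ball 0 r) = Set.univ

namespace NestedCovering

variable {C : Type*} [TopologicalSpace C] [ChartedSpace ℂ C]
  {ι : Type*} (𝒰 : NestedCovering C ι)

/-- The nested open set `U_j^r`. -/
def nest (r : ℝ) (j : ι) : Set C :=
  (𝒰.chart j).source ∩ 𝒰.chart j ⁻¹' Metric.ball 0 r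

variable {E : C → Type*} [∀ x, AddCommGroup (E x)] [∀ x, Module ℂ (E x)]
  [∀ x, TopologicalSpace (E x)] [TopologicalSpace (TotalSpace ℂ E)]
  [FiberBundle ℂ E] [VectorBundle ℂ ℂ E]

/-- `u = (u_j)` is a Čech `0`-cochain of `𝒰^r` with values in the sheaf of holomorphic sections of
`E`; only the values of `u_j` on `U_j^r` matter. -/
def IsZeroCochain (r : ℝ) (u : ι → ∀ x, E x) : Prop :=
  ∀ j, IsHolomorphicOn (u j) (𝒰.nest r j)

/-- `δu = f`, that is, `f_{jk} = u_k - u_j` on `U_j^r ∩ U_k^r` for all `j`, `k`. -/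
def CoboundaryEq (r : ℝ) (u : ι → ∀ x, E x) (f : ι → ι → ∀ x, E x) : Prop :=
  ∀ j k, ∀ x ∈ 𝒰.nest r j ∩ 𝒰.nest r k, f j k x = u k x - u j x

/-- `f = (f_{jk})` is a Čech `1`-coboundary of `𝒰^r` with values in the sheaf of holomorphic
sections of `E`; only the values of `f_{jk}` on `U_j^r ∩ U_k^r` matter. -/
def IsOneCoboundary (r : ℝ) (f : ι → ι → ∀ x, E x) : Prop :=
  ∃ v : ι → ∀ x, E x, 𝒰.IsZeroCochain r v ∧ 𝒰.CoboundaryEq r v f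

variable [IsManifold 𝓘(ℂ, ℂ) ω C] [MeasurableSpace C]

/-- The norm `max_j ‖u_j‖_{L², U_j^r}` of a `0`-cochain. -/
def norm₀ (g : HermitianMetric (TangentSpace 𝓘(ℂ, ℂ) : C → Type _)) (h : HermitianMetric E)
    (r : ℝ) (u : ι → ∀ x, E x) : ℝ≥0∞ :=
  ⨆ j, l2Norm g h (𝒰.nest r j) (u j)

/-- The norm `max_{j,k} ‖f_{jk}‖_{L², U_j^r ∩ U_k^r}` of a `1`-cochain. -/
def norm₁ (g : HermitianMetric (TangentSpace 𝓘(ℂ, ℂ) : C → Type _)) (h : HermitianMetric E)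
    (r : ℝ) (f : ι → ι → ∀ x, E x) : ℝ≥0∞ :=
  ⨆ j, ⨆ k, l2Norm g h (𝒰.nest r j ∩ 𝒰.nest r k) (f j k)

end NestedCovering

end

end RiemannSurface

/-!
The primitive is built by the `∂̄`-correction of a smooth primitive. Let `f = δv` be a coboundary on
`𝒰^r`. Fix, once and for all, a smooth partition of unity `χ_k` with supports in the smallest sets
`U_k^{r_*}` (`NestedCovering.exists_partition`); as these lie in `U_k^r` for every admissible `r`, the
same functions serve all radii. The sum `w = ∑ χ_k v_k` is a smooth global section of the bundle,
and since `∑ χ_k = 1`, on `U_j^r` one has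

* `w - v_j = ∑ χ_k (v_k - v_j) = ∑ χ_k f_{jk}`, whose `L²`-norm is at most a multiple of `‖f‖`;
* `∂̄w = ∑ ∂̄χ_k (v_k - v_j) = ∑ ∂̄χ_k f_{jk}` (`dbar_glue_apply`), whose `L²`-norm is at most a multiple
  of `‖f‖` because `|∂̄χ_k|_g` is bounded on the compact surface
  (`exists_forall_norm_dbarFun_sq_le`).

The form `∂̄w` has trivial Dolbeault class, so Hörmander's estimate gives `η` with `∂̄η = ∂̄w` and
`‖η‖ ≤ c ‖∂̄w‖`. Then `u_j = v_j - w + η` is holomorphic on `U_j^r`, by the Cauchy-Riemann equations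
(`IsHolomorphicOn.sub_add_of_dbar_eq`), has `δu = δv = f`, and satisfies the estimate
(`NestedCovering.exists_primitive_of_isHormanderConstant`).

The infimum `K_Hö` need not be attained, so one takes an admissible `c < K_Hö + 1` and absorbs the
excess into `α`. If no constant is admissible, the right-hand side is infinite unless `‖f‖ = 0`; in
that case `f = 0`, because the volume measure charges every nonempty open set
(`isOpenPosMeasure_volumeMeasure`), and `u = 0` is a primitive.
-/

open Filter Topology

set_option linter.unusedSectionVars false

namespace RiemannSurface

/-! ### Real and complex differentiability on a Riemann surface -/

section RealStructure

variable {M N : Type*} [TopologicalSpace M] [ChartedSpace ℂ M]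
  [TopologicalSpace N] [ChartedSpace ℂ N]

theorem isManifold_one (M : Type*) [TopologicalSpace M] [ChartedSpace ℂ M]
    [IsManifold 𝓘(ℂ, ℂ) ω M] : IsManifold 𝓘(ℂ, ℂ) 1 M :=
  IsManifold.of_le (n := ω) le_top

/-- A complex derivative is also the real derivative. The ascription reads `f'` as a map of `ℂ`, which
all the tangent spaces unfold to, whatever the scalar field of the model. -/
theorem hasMFDerivAt_restrictScalars {f : M → N} {x : M}
    {f' : TangentSpace 𝓘(ℂ, ℂ) x →L[ℂ] TangentSpace 𝓘(ℂ, ℂ) (f x)}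
    (hf : HasMFDerivAt 𝓘(ℂ, ℂ) 𝓘(ℂ, ℂ) f x f') :
    HasMFDerivAt 𝓘(ℝ, ℂ) 𝓘(ℝ, ℂ) f x
      (ContinuousLinearMap.restrictScalars ℝ (show ℂ →L[ℂ] ℂ from f') : ℂ →L[ℝ] ℂ) :=
  ⟨hf.1, HasFDerivWithinAt.restrictScalars ℝ hf.2⟩

theorem mdifferentiableAt_real {f : M → N} {x : M}
    (hf : MDifferentiableAt 𝓘(ℂ, ℂ) 𝓘(ℂ, ℂ) f x) :
    MDifferentiableAt 𝓘(ℝ, ℂ) 𝓘(ℝ, ℂ) f x :=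
  (hasMFDerivAt_restrictScalars hf.hasMFDerivAt).mdifferentiableAt

theorem mfderiv_real_apply {f : M → N} {x : M}
    (hf : MDifferentiableAt 𝓘(ℂ, ℂ) 𝓘(ℂ, ℂ) f x) (v : ℂ) :
    (mfderiv 𝓘(ℝ, ℂ) 𝓘(ℝ, ℂ) f x : ℂ →L[ℝ] ℂ) v
      = (mfderiv 𝓘(ℂ, ℂ) 𝓘(ℂ, ℂ) f x : ℂ →L[ℂ] ℂ) v := by
  rw [(hasMFDerivAt_restrictScalars hf.hasMFDerivAt).mfderiv]
  rfl

/-- A complex-differentiable map is real smooth, because it is analytic in coordinates. -/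
theorem contMDiffAt_real_of_eventually_mdifferentiableAt [IsManifold 𝓘(ℂ, ℂ) ω M]
    {f : M → ℂ} {x : M} (hf : ∀ᶠ y in 𝓝 x, MDifferentiableAt 𝓘(ℂ, ℂ) 𝓘(ℂ, ℂ) f y) :
    ContMDiffAt 𝓘(ℝ, ℂ) 𝓘(ℝ, ℂ) ∞ f x := by
  have hc : ContinuousAt f x := hf.self_of_nhds.continuousAt
  obtain ⟨U, hUf, hU, hxU⟩ := eventually_nhds_iff.1 hf
  have key : ∀ᶠ z in 𝓝 (chartAt ℂ x x), DifferentiableAt ℂ (f ∘ (chartAt ℂ x).symm) z := by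
    have h1 : ∀ᶠ z in 𝓝 (chartAt ℂ x x), z ∈ (chartAt ℂ x).target :=
      (chartAt ℂ x).open_target.mem_nhds ((chartAt ℂ x).map_source (mem_chart_source ℂ x))
    have h2 : ∀ᶠ z in 𝓝 (chartAt ℂ x x), (chartAt ℂ x).symm z ∈ U := by
      refine ((chartAt ℂ x).symm.continuousAt (by simp)).eventually ?_
      rw [(chartAt ℂ x).left_inv (mem_chart_source ℂ x)]
      exact hU.mem_nhds hxU
    filter_upwards [h1, h2] with z hz hz'
    have := MDifferentiableAt.comp z (hUf _ hz') (mdifferentiableAt_atlas_symm (I := 𝓘(ℂ, ℂ)) (chart_mem_atlas ℂ x) hz)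
    exact this.differentiableAt
  have han : AnalyticAt ℂ (f ∘ (chartAt ℂ x).symm) (chartAt ℂ x x) :=
    Complex.analyticAt_iff_eventually_differentiableAt.2 key
  refine ⟨hc.continuousWithinAt, ?_⟩
  have := (han.contDiffAt (n := ∞)).restrict_scalars ℝ
  exact this.contDiffWithinAt

/-- A holomorphic atlas is a smooth atlas of the underlying real surface. -/
instance isManifold_real [IsManifold 𝓘(ℂ, ℂ) ω M] : IsManifold 𝓘(ℝ, ℂ) ∞ M := by
  refine isManifold_of_contDiffOn _ _ _ fun e e' he he' => ?_
  have h := (contDiffGroupoid ω 𝓘(ℂ, ℂ)).compatible he he'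
  have h1 : ContDiffOn ℂ ω (𝓘(ℂ, ℂ) ∘ (e.symm ≫ₕ e') ∘ 𝓘(ℂ, ℂ).symm)
    (𝓘(ℂ, ℂ).symm ⁻¹' (e.symm ≫ₕ e').source ∩ Set.range 𝓘(ℂ, ℂ)) := h.1
  exact (h1.restrict_scalars ℝ).of_le (by simp)

end RealStructure

/-! ### Local frames and Hermitian metrics -/

section Fibre

variable {C : Type*} [TopologicalSpace C]
  {E : C → Type*} [∀ x, AddCommGroup (E x)] [∀ x, Module ℂ (E x)]
  [∀ x, TopologicalSpace (E x)] [TopologicalSpace (TotalSpace ℂ E)]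
  [FiberBundle ℂ E] [VectorBundle ℂ ℂ E]

/-- The section `s` read in the preferred local trivialization around `x₀`. -/
noncomputable def localCoord (s : ∀ x, E x) (x₀ : C) (y : C) : ℂ :=
  (trivializationAt ℂ E x₀ (TotalSpace.mk' ℂ y (s y))).2

/-- The distinguished local holomorphic frame around `x₀`. -/
noncomputable def localFrame (E : C → Type*) [∀ x, AddCommGroup (E x)] [∀ x, Module ℂ (E x)]
    [∀ x, TopologicalSpace (E x)] [TopologicalSpace (TotalSpace ℂ E)]
    [FiberBundle ℂ E] [VectorBundle ℂ ℂ E] (x₀ y : C) : E y :=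
  (trivializationAt ℂ E x₀).symm y 1

theorem coord_smul_localFrame {x₀ y : C} (hy : y ∈ (trivializationAt ℂ E x₀).baseSet) (v : E y) :
    (trivializationAt ℂ E x₀ (TotalSpace.mk' ℂ y v)).2 • localFrame E x₀ y = v := by
  have h := ((trivializationAt ℂ E x₀).symmₗ ℂ y).map_smul
    (trivializationAt ℂ E x₀ (TotalSpace.mk' ℂ y v)).2 (1 : ℂ)
  rw [smul_eq_mul, mul_one, Trivialization.coe_symmₗ _ hy] at h
  exact h.symm.trans ((trivializationAt ℂ E x₀).symm_apply_apply_mk hy v)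

theorem coord_add {x₀ y : C} (hy : y ∈ (trivializationAt ℂ E x₀).baseSet) (v w : E y) :
    (trivializationAt ℂ E x₀ (TotalSpace.mk' ℂ y (v + w))).2 =
      (trivializationAt ℂ E x₀ (TotalSpace.mk' ℂ y v)).2 +
        (trivializationAt ℂ E x₀ (TotalSpace.mk' ℂ y w)).2 :=
  ((trivializationAt ℂ E x₀).linear ℂ hy).map_add v w

theorem coord_smul {x₀ y : C} (hy : y ∈ (trivializationAt ℂ E x₀).baseSet) (c : ℂ) (v : E y) :
    (trivializationAt ℂ E x₀ (TotalSpace.mk' ℂ y (c • v))).2 =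
      c * (trivializationAt ℂ E x₀ (TotalSpace.mk' ℂ y v)).2 :=
  ((trivializationAt ℂ E x₀).linear ℂ hy).map_smul c v

theorem coord_zero {x₀ y : C} (hy : y ∈ (trivializationAt ℂ E x₀).baseSet) :
    (trivializationAt ℂ E x₀ (TotalSpace.mk' ℂ y (0 : E y))).2 = 0 := by
  simpa using coord_smul hy 0 (0 : E y)

theorem symmₗ_coord {x : C} (v : E x) :
    (trivializationAt ℂ E x).symmₗ ℂ x (trivializationAt ℂ E x (TotalSpace.mk' ℂ x v)).2 = v := by
  rw [Trivialization.coe_symmₗ _ (mem_baseSet_trivializationAt ℂ E x)]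
  exact (trivializationAt ℂ E x).symm_apply_apply_mk (mem_baseSet_trivializationAt ℂ E x) v

theorem eventually_mem_baseSet (E : C → Type*) [∀ x, AddCommGroup (E x)] [∀ x, Module ℂ (E x)]
    [∀ x, TopologicalSpace (E x)] [TopologicalSpace (TotalSpace ℂ E)]
    [FiberBundle ℂ E] [VectorBundle ℂ ℂ E] (x : C) :
    ∀ᶠ y in 𝓝 x, y ∈ (trivializationAt ℂ E x).baseSet :=
  (trivializationAt ℂ E x).open_baseSet.mem_nhds (mem_baseSet_trivializationAt ℂ E x)

variable [ChartedSpace ℂ C]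

namespace HermitianMetric

variable (h : HermitianMetric E)

theorem normSq_smul (x : C) (c : ℂ) (v : E x) : h.normSq x (c • v) = ‖c‖ ^ 2 * h.normSq x v := by
  rw [normSq, normSq, map_smul, LinearMap.map_smulₛₗ, LinearMap.smul_apply, smul_smul,
    smul_eq_mul, Complex.mul_conj, Complex.normSq_eq_norm_sq, Complex.re_ofReal_mul]

theorem normSq_zero (x : C) : h.normSq x (0 : E x) = 0 := by
  simp [normSq]

theorem normSq_pos {x : C} {v : E x} (hv : v ≠ 0) : 0 < h.normSq x v := h.pos_def x v hv

theorem normSq_nonneg (x : C) (v : E x) : 0 ≤ h.normSq x v := by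
  by_cases hv : v = 0
  · rw [hv, normSq_zero]
  · exact (h.normSq_pos hv).le

theorem normSq_neg (x : C) (v : E x) : h.normSq x (-v) = h.normSq x v := by
  simpa using h.normSq_smul x (-1) v

theorem normSq_sub_comm (x : C) (v w : E x) : h.normSq x (v - w) = h.normSq x (w - v) := by
  rw [← neg_sub, normSq_neg]

/-- As the fibre is one-dimensional, the metric is a multiple of the standard one. -/
theorem normSq_eq {x₀ y : C} (hy : y ∈ (trivializationAt ℂ E x₀).baseSet) (v : E y) :
    h.normSq y v = ‖(trivializationAt ℂ E x₀ (TotalSpace.mk' ℂ y v)).2‖ ^ 2 *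
      h.normSq y (localFrame E x₀ y) := by
  rw [← normSq_smul, coord_smul_localFrame hy]

theorem normSq_sum_le {κ : Type*} (x : C) (s : Finset κ) (a : κ → E x) :
    h.normSq x (∑ k ∈ s, a k) ≤ s.card * ∑ k ∈ s, h.normSq x (a k) := by
  have hx := mem_baseSet_trivializationAt ℂ E x
  have hsum : (trivializationAt ℂ E x (TotalSpace.mk' ℂ x (∑ k ∈ s, a k))).2 =
      ∑ k ∈ s, (trivializationAt ℂ E x (TotalSpace.mk' ℂ x (a k))).2 :=
    map_sum (IsLinearMap.mk' _ ((trivializationAt ℂ E x).linear ℂ hx)) a s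
  rw [h.normSq_eq hx, hsum, Finset.sum_congr rfl fun k _ => h.normSq_eq hx (a k),
    ← Finset.sum_mul, ← mul_assoc]
  refine mul_le_mul_of_nonneg_right ?_ (h.normSq_nonneg _ _)
  calc _ ≤ (∑ k ∈ s, ‖(trivializationAt ℂ E x (TotalSpace.mk' ℂ x (a k))).2‖) ^ 2 := by
        gcongr
        exact norm_sum_le _ _
    _ ≤ _ := sq_sum_le_card_mul_sum_sq

theorem normSq_add_le (x : C) (v w : E x) :
    h.normSq x (v + w) ≤ 2 * (h.normSq x v + h.normSq x w) := by
  simpa using h.normSq_sum_le x Finset.univ ![v, w]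

theorem localFrame_ne_zero {x₀ y : C} (hy : y ∈ (trivializationAt ℂ E x₀).baseSet) :
    localFrame E x₀ y ≠ 0 := by
  intro h0
  have h1 : (trivializationAt ℂ E x₀ (TotalSpace.mk' ℂ y (localFrame E x₀ y))).2 = 1 := by
    rw [localFrame]
    exact congrArg Prod.snd ((trivializationAt ℂ E x₀).apply_mk_symm hy 1)
  rw [h0, coord_zero hy] at h1
  exact zero_ne_one h1

theorem continuousOn_normSq_localFrame (x₀ : C) :
    ContinuousOn (fun y => h.normSq y (localFrame E x₀ y)) (trivializationAt ℂ E x₀).baseSet :=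
  (h.smooth x₀).continuousOn

theorem continuousAt_normSq {s : ∀ x, E x} {x : C}
    (hs : ContinuousAt (fun y => TotalSpace.mk' ℂ y (s y)) x) :
    ContinuousAt (fun y => h.normSq y (s y)) x := by
  have h1 := ((FiberBundle.continuousAt_totalSpace ℂ _).1 hs).2
  have h2 := (h.continuousOn_normSq_localFrame x).continuousAt (eventually_mem_baseSet E x)
  refine ((h1.norm.pow 2).mul h2).congr ?_
  filter_upwards [eventually_mem_baseSet E x] with y hy
  exact (h.normSq_eq hy (s y)).symm

end HermitianMetric

/-! ### Calculus of the Dolbeault operator -/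

section Scalar

variable {f f₁ f₂ : C → ℂ} {x : C}

theorem dbarFun_apply (f : C → ℂ) (x : C) (ξ : TangentSpace 𝓘(ℂ, ℂ) x) :
    dbarFun f x ξ = (realDiff f x ξ + Complex.I * realDiff f x (Complex.I • ξ)) / 2 := rfl

theorem realDiff_of_hasMFDerivAt {D : ℂ →L[ℝ] ℂ}
    (h : HasMFDerivAt 𝓘(ℝ, ℂ) 𝓘(ℝ, ℂ) f x D) (ξ : TangentSpace 𝓘(ℂ, ℂ) x) :
    realDiff f x ξ = D ξ := by
  have e : (mfderiv 𝓘(ℝ, ℂ) 𝓘(ℝ, ℂ) f x : ℂ →L[ℝ] ℂ) = D := h.mfderiv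
  exact congrArg (fun L : ℂ →L[ℝ] ℂ => L ξ) e

theorem dbarFun_congr (h : f₁ =ᶠ[𝓝 x] f₂) : dbarFun f₁ x = dbarFun f₂ x := by
  have key : ∀ ξ, realDiff f₁ x ξ = realDiff f₂ x ξ := fun ξ =>
    congrArg (fun L : ℂ →L[ℝ] ℂ => L ξ) (h.mfderiv_eq (I := 𝓘(ℝ, ℂ)) (I' := 𝓘(ℝ, ℂ)))
  refine LinearMap.ext fun ξ => ?_
  rw [dbarFun_apply, dbarFun_apply, key, key]

theorem dbarFun_add (h₁ : MDifferentiableAt 𝓘(ℝ, ℂ) 𝓘(ℝ, ℂ) f₁ x)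
    (h₂ : MDifferentiableAt 𝓘(ℝ, ℂ) 𝓘(ℝ, ℂ) f₂ x) :
    dbarFun (fun y => f₁ y + f₂ y) x = dbarFun f₁ x + dbarFun f₂ x := by
  have key : ∀ ξ, realDiff (fun y => f₁ y + f₂ y) x ξ = realDiff f₁ x ξ + realDiff f₂ x ξ := by
    intro ξ
    exact realDiff_of_hasMFDerivAt (h₁.hasMFDerivAt.add h₂.hasMFDerivAt) ξ
  refine LinearMap.ext fun ξ => ?_
  simp only [dbarFun_apply, key, LinearMap.add_apply]
  ring

theorem dbarFun_mul (h₁ : MDifferentiableAt 𝓘(ℝ, ℂ) 𝓘(ℝ, ℂ) f₁ x)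
    (h₂ : MDifferentiableAt 𝓘(ℝ, ℂ) 𝓘(ℝ, ℂ) f₂ x) :
    dbarFun (fun y => f₁ y * f₂ y) x = f₁ x • dbarFun f₂ x + f₂ x • dbarFun f₁ x := by
  have key : ∀ ξ, realDiff (fun y => f₁ y * f₂ y) x ξ =
      f₁ x * realDiff f₂ x ξ + f₂ x * realDiff f₁ x ξ := by
    intro ξ
    exact realDiff_of_hasMFDerivAt (h₁.hasMFDerivAt.mul h₂.hasMFDerivAt) ξ
  refine LinearMap.ext fun ξ => ?_
  simp only [dbarFun_apply, key, LinearMap.add_apply, LinearMap.smul_apply, smul_eq_mul]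
  ring

theorem dbarFun_const (c : ℂ) : dbarFun (fun _ : C => c) x = 0 := by
  refine LinearMap.ext fun ξ => ?_
  have key : ∀ ζ, realDiff (fun _ : C => c) x ζ = 0 :=
    fun ζ => realDiff_of_hasMFDerivAt (hasMFDerivAt_const c x) ζ
  simp [dbarFun_apply, key]

theorem dbarFun_sum {κ : Type*} (s : Finset κ) (F : κ → C → ℂ)
    (hF : ∀ k ∈ s, MDifferentiableAt 𝓘(ℝ, ℂ) 𝓘(ℝ, ℂ) (F k) x) :
    dbarFun (fun y => ∑ k ∈ s, F k y) x = ∑ k ∈ s, dbarFun (F k) x := by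
  classical
  suffices H : MDifferentiableAt 𝓘(ℝ, ℂ) 𝓘(ℝ, ℂ) (fun y => ∑ k ∈ s, F k y) x ∧
      dbarFun (fun y => ∑ k ∈ s, F k y) x = ∑ k ∈ s, dbarFun (F k) x from H.2
  induction s using Finset.induction_on with
  | empty => simpa using! ⟨mdifferentiableAt_const, dbarFun_const 0⟩
  | insert a s ha ih =>
    obtain ⟨h1, h2⟩ := ih fun k hk => hF k (Finset.mem_insert_of_mem hk)
    have h3 := hF a (Finset.mem_insert_self a s)
    simp only [Finset.sum_insert ha]
    exact ⟨h3.add h1, by rw [dbarFun_add h3 h1, h2]⟩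

theorem dbarFun_eq_zero (h : MDifferentiableAt 𝓘(ℂ, ℂ) 𝓘(ℂ, ℂ) f x) : dbarFun f x = 0 := by
  refine LinearMap.ext fun ξ => ?_
  have key : ∀ ζ : TangentSpace 𝓘(ℂ, ℂ) x,
      realDiff f x ζ = (mfderiv 𝓘(ℂ, ℂ) 𝓘(ℂ, ℂ) f x : ℂ →L[ℂ] ℂ) ζ :=
    fun ζ => mfderiv_real_apply h ζ
  have hI := (mfderiv 𝓘(ℂ, ℂ) 𝓘(ℂ, ℂ) f x : ℂ →L[ℂ] ℂ).map_smul Complex.I ξ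
  have hI' : realDiff f x (Complex.I • ξ) = Complex.I * realDiff f x ξ := by
    rw [key, key]
    exact hI
  rw [dbarFun_apply, hI', LinearMap.zero_apply]
  linear_combination (realDiff f x ξ / 2) * Complex.I_sq

/-- The Cauchy-Riemann equations: a real-differentiable function whose `∂̄` vanishes at a point is
complex-differentiable there. -/
theorem mdifferentiableAt_of_dbarFun_eq_zero
    (h : MDifferentiableAt 𝓘(ℝ, ℂ) 𝓘(ℝ, ℂ) f x) (h0 : dbarFun f x = 0) :
    MDifferentiableAt 𝓘(ℂ, ℂ) 𝓘(ℂ, ℂ) f x := by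
  have hd := h.hasMFDerivAt
  set D : ℂ →L[ℝ] ℂ := mfderiv 𝓘(ℝ, ℂ) 𝓘(ℝ, ℂ) f x with hD
  have hI : D Complex.I = Complex.I * D 1 := by
    have h1 := LinearMap.congr_fun h0 (1 : ℂ)
    have h2 : (D 1 + Complex.I * D (Complex.I • (1 : ℂ))) / 2 = 0 := h1
    rw [smul_eq_mul, mul_one] at h2
    have h3 : D 1 + Complex.I * D Complex.I = 0 := by simpa using h2
    linear_combination (-Complex.I) * h3 + D Complex.I * Complex.I_sq
  have hD' : D = ContinuousLinearMap.restrictScalars ℝ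
      (ContinuousLinearMap.toSpanSingleton ℂ (D 1)) := by
    refine ContinuousLinearMap.ext fun z => ?_
    have hz : z = z.re • (1 : ℂ) + z.im • Complex.I := by
      simp [Complex.re_add_im]
    conv_lhs => rw [hz, map_add, map_smul, map_smul, hI]
    rw [ContinuousLinearMap.coe_restrictScalars', ContinuousLinearMap.toSpanSingleton_apply,
      smul_eq_mul, Complex.real_smul, Complex.real_smul]
    linear_combination (D 1) * Complex.re_add_im z
  have H : HasFDerivWithinAt (writtenInExtChartAt 𝓘(ℝ, ℂ) 𝓘(ℝ, ℂ) x f)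
      (ContinuousLinearMap.restrictScalars ℝ (ContinuousLinearMap.toSpanSingleton ℂ (D 1)))
      (Set.range 𝓘(ℝ, ℂ)) (extChartAt 𝓘(ℝ, ℂ) x x) := hD' ▸ hd.2
  have H2 : HasFDerivWithinAt (𝕜 := ℂ) (writtenInExtChartAt 𝓘(ℂ, ℂ) 𝓘(ℂ, ℂ) x f)
      (ContinuousLinearMap.toSpanSingleton ℂ (D 1))
      (Set.range 𝓘(ℂ, ℂ)) (extChartAt 𝓘(ℂ, ℂ) x x) :=
    HasFDerivWithinAt.of_restrictScalars ℝ H rfl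
  exact HasMFDerivAt.mdifferentiableAt ⟨hd.1, H2⟩

end Scalar

theorem dbar_apply (s : ∀ x, E x) (x : C) (ξ : TangentSpace 𝓘(ℂ, ℂ) x) :
    dbar s x ξ = (trivializationAt ℂ E x).symmₗ ℂ x (dbarFun (localCoord s x) x ξ) := rfl

/-- `∂̄s` and the holomorphy or smoothness of `s` at `x` are all read in the same trivialization,
the preferred one at `x`, so no change of trivialization intervenes in comparing them. -/
theorem coord_dbar (s : ∀ x, E x) (x : C) (ξ : TangentSpace 𝓘(ℂ, ℂ) x) :
    (trivializationAt ℂ E x (TotalSpace.mk' ℂ x (dbar s x ξ))).2 = dbarFun (localCoord s x) x ξ := by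
  have hx := mem_baseSet_trivializationAt ℂ E x
  rw [dbar_apply, Trivialization.coe_symmₗ _ hx]
  exact congrArg Prod.snd ((trivializationAt ℂ E x).apply_mk_symm hx _)

theorem isSmoothSection_iff {s : ∀ x, E x} :
    IsSmoothSection s ↔ ∀ x, ContMDiffAt 𝓘(ℝ, ℂ) 𝓘(ℝ, ℂ) ∞ (localCoord s x) x :=
  forall_congr' fun x => contMDiffAt_section x

theorem IsHolomorphicOn.mdifferentiableAt_localCoord {s : ∀ x, E x} {U : Set C}
    (hs : IsHolomorphicOn s U) (hU : IsOpen U) {x : C} (hx : x ∈ U) :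
    MDifferentiableAt 𝓘(ℂ, ℂ) 𝓘(ℂ, ℂ) (localCoord s x) x :=
  (mdifferentiableAt_section 𝓘(ℂ, ℂ) s).1 ((hs x hx).mdifferentiableAt (hU.mem_nhds hx))

theorem isHolomorphicOn_of_mdifferentiableAt_localCoord {s : ∀ x, E x} {U : Set C}
    (hs : ∀ x ∈ U, MDifferentiableAt 𝓘(ℂ, ℂ) 𝓘(ℂ, ℂ) (localCoord s x) x) :
    IsHolomorphicOn s U :=
  fun x hx => ((mdifferentiableAt_section 𝓘(ℂ, ℂ) s).2 (hs x hx)).mdifferentiableWithinAt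

/-- Holomorphy at the points near `x`, each in its own trivialization, is transferred to the
trivialization at `x`; there the section is an analytic function. -/
theorem IsHolomorphicOn.contMDiffAt_localCoord [IsManifold 𝓘(ℂ, ℂ) ω C]
    [ContMDiffVectorBundle ω ℂ E 𝓘(ℂ, ℂ)] {s : ∀ x, E x} {U : Set C}
    (hs : IsHolomorphicOn s U) (hU : IsOpen U) {x : C} (hx : x ∈ U) :
    ContMDiffAt 𝓘(ℝ, ℂ) 𝓘(ℝ, ℂ) ∞ (localCoord s x) x := by
  have : ContMDiffVectorBundle 1 ℂ E 𝓘(ℂ, ℂ) := ContMDiffVectorBundle.of_le (n := ω) le_top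
  have := isManifold_one C
  refine contMDiffAt_real_of_eventually_mdifferentiableAt ?_
  filter_upwards [eventually_mem_baseSet E x, hU.mem_nhds hx] with y hy hyU
  exact ((trivializationAt ℂ E x).mdifferentiableAt_section_iff 𝓘(ℂ, ℂ) s hy).1
    ((hs y hyU).mdifferentiableAt (hU.mem_nhds hyU))

theorem IsHolomorphicOn.continuousAt {s : ∀ x, E x} {U : Set C}
    (hs : IsHolomorphicOn s U) (hU : IsOpen U) {x : C} (hx : x ∈ U) :
    ContinuousAt (fun y => TotalSpace.mk' ℂ y (s y)) x :=
  ((hs x hx).mdifferentiableAt (hU.mem_nhds hx)).continuousAt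

theorem IsHolomorphicOn.sub {s t : ∀ x, E x} {U : Set C} (hU : IsOpen U)
    (hs : IsHolomorphicOn s U) (ht : IsHolomorphicOn t U) :
    IsHolomorphicOn (fun x => s x - t x) U := by
  refine isHolomorphicOn_of_mdifferentiableAt_localCoord fun x hx => ?_
  refine ((hs.mdifferentiableAt_localCoord hU hx).sub
    (ht.mdifferentiableAt_localCoord hU hx)).congr_of_eventuallyEq ?_
  filter_upwards [eventually_mem_baseSet E x] with y hy
  exact ((trivializationAt ℂ E x).linear ℂ hy).map_sub (s y) (t y)

section Gluing

variable {κ : Type*} [Fintype κ] {χ : κ → C → ℂ} {V : κ → Set C} {v : κ → ∀ x, E x}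

/-- The global section `∑ k, χ k • v k` glued from local sections by cut-off functions. -/
noncomputable def glue (χ : κ → C → ℂ) (v : κ → ∀ x, E x) (y : C) : E y := ∑ k, χ k y • v k y

theorem localCoord_glue (x : C) :
    localCoord (glue χ v) x =ᶠ[𝓝 x] fun y => ∑ k, χ k y * localCoord (v k) x y := by
  filter_upwards [eventually_mem_baseSet E x] with y hy
  have h := map_sum (IsLinearMap.mk' _ ((trivializationAt ℂ E x).linear ℂ hy))
    (fun k => χ k y • v k y) Finset.univ
  refine h.trans (Finset.sum_congr rfl fun k _ => ?_)
  exact coord_smul hy _ _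

variable [IsManifold 𝓘(ℂ, ℂ) ω C] [ContMDiffVectorBundle ω ℂ E 𝓘(ℂ, ℂ)]

theorem contMDiffAt_cutoff_mul {χ : C → ℂ} {V : Set C} {v : ∀ x, E x}
    (hχ : ContMDiff 𝓘(ℝ, ℂ) 𝓘(ℝ, ℂ) ∞ χ) (hV : IsOpen V) (hsupp : tsupport χ ⊆ V)
    (hv : IsHolomorphicOn v V) (x : C) :
    ContMDiffAt 𝓘(ℝ, ℂ) 𝓘(ℝ, ℂ) ∞ (fun y => χ y * localCoord v x y) x := by
  by_cases hx : x ∈ V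
  · exact (contDiff_mul (𝕜 := ℝ) (𝔸 := ℂ)).contMDiff.contMDiffAt.comp x
      ((hχ x).prodMk_space (hv.contMDiffAt_localCoord hV hx))
  · have h0 : χ =ᶠ[𝓝 x] 0 := notMem_tsupport_iff_eventuallyEq.1 fun h => hx (hsupp h)
    refine (contMDiffAt_const (c := (0 : ℂ))).congr_of_eventuallyEq ?_
    filter_upwards [h0] with y hy
    simp [hy]

/-- Outside `V`, where `v` is arbitrary, both sides vanish because `χ` does so near the point. -/
theorem dbarFun_cutoff_mul {χ : C → ℂ} {V : Set C} {v : ∀ x, E x}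
    (hχ : ContMDiff 𝓘(ℝ, ℂ) 𝓘(ℝ, ℂ) ∞ χ) (hV : IsOpen V) (hsupp : tsupport χ ⊆ V)
    (hv : IsHolomorphicOn v V) (x : C) :
    dbarFun (fun y => χ y * localCoord v x y) x = localCoord v x x • dbarFun χ x := by
  by_cases hx : x ∈ V
  · have h := hv.mdifferentiableAt_localCoord hV hx
    rw [dbarFun_mul ((hχ x).mdifferentiableAt (by simp)) (mdifferentiableAt_real h),
      dbarFun_eq_zero h, smul_zero, zero_add]
  · have h0 : χ =ᶠ[𝓝 x] 0 := notMem_tsupport_iff_eventuallyEq.1 fun h => hx (hsupp h)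
    have h1 : (fun y => χ y * localCoord v x y) =ᶠ[𝓝 x] fun _ => 0 := by
      filter_upwards [h0] with y hy
      simp [hy]
    have h2 : χ =ᶠ[𝓝 x] fun _ => (0 : ℂ) := h0
    rw [dbarFun_congr h1, dbarFun_congr h2, dbarFun_const, smul_zero]

theorem isSmoothSection_glue (hχ : ∀ k, ContMDiff 𝓘(ℝ, ℂ) 𝓘(ℝ, ℂ) ∞ (χ k))
    (hV : ∀ k, IsOpen (V k)) (hsupp : ∀ k, tsupport (χ k) ⊆ V k)
    (hv : ∀ k, IsHolomorphicOn (v k) (V k)) : IsSmoothSection (glue χ v) := by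
  refine isSmoothSection_iff.2 fun x => ?_
  refine ContMDiffAt.congr_of_eventuallyEq ?_ (localCoord_glue x)
  exact contMDiffAt_finsetSum fun k _ =>
    contMDiffAt_cutoff_mul (hχ k) (hV k) (hsupp k) (hv k) x

/-- As the `v k` are holomorphic, `∂̄(∑ k, χ k • v k) = ∑ k, ∂̄(χ k) ⊗ v k`; and since
`∑ k, ∂̄(χ k) = 0`, any fixed vector may be subtracted from all the `v k`. -/
theorem dbar_glue_apply (hχ : ∀ k, ContMDiff 𝓘(ℝ, ℂ) 𝓘(ℝ, ℂ) ∞ (χ k))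
    (hV : ∀ k, IsOpen (V k)) (hsupp : ∀ k, tsupport (χ k) ⊆ V k)
    (hv : ∀ k, IsHolomorphicOn (v k) (V k)) (hsum : ∀ y, ∑ k, χ k y = 1) (x : C)
    (ξ : TangentSpace 𝓘(ℂ, ℂ) x) (a : E x) :
    dbar (glue χ v) x ξ = ∑ k, dbarFun (χ k) x ξ • (v k x - a) := by
  have h1 : ∑ k, dbarFun (χ k) x ξ = 0 := by
    have h := dbarFun_sum (x := x) Finset.univ χ fun k _ => ((hχ k) x).mdifferentiableAt (by simp)
    rw [show (fun y => ∑ k, χ k y) = fun _ => (1 : ℂ) from funext hsum, dbarFun_const] at h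
    have := LinearMap.congr_fun h.symm ξ
    simpa using this
  have h2 : dbarFun (localCoord (glue χ v) x) x =
      ∑ k, localCoord (v k) x x • dbarFun (χ k) x := by
    rw [dbarFun_congr (localCoord_glue x), dbarFun_sum]
    · exact Finset.sum_congr rfl fun k _ =>
        dbarFun_cutoff_mul (hχ k) (hV k) (hsupp k) (hv k) x
    · exact fun k _ => (contMDiffAt_cutoff_mul (hχ k) (hV k) (hsupp k) (hv k)
        x).mdifferentiableAt (by simp)
  rw [dbar_apply, h2]
  simp only [smul_sub, Finset.sum_sub_distrib, ← Finset.sum_smul, h1, zero_smul, sub_zero,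
    LinearMap.sum_apply, map_sum]
  refine Finset.sum_congr rfl fun k _ => ?_
  rw [LinearMap.smul_apply, smul_eq_mul, mul_comm, ← smul_eq_mul, map_smul]
  congr 1
  exact symmₗ_coord (v k x)

end Gluing

/-- Correcting a holomorphic section by two smooth sections with equal `∂̄` leaves it holomorphic. -/
theorem IsHolomorphicOn.sub_add_of_dbar_eq {s w η : ∀ x, E x} {U : Set C} (hU : IsOpen U)
    (hs : IsHolomorphicOn s U) (hw : IsSmoothSection w) (hη : IsSmoothSection η)
    (h : dbar η = dbar w) : IsHolomorphicOn (fun x => s x + (η x - w x)) U := by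
  refine isHolomorphicOn_of_mdifferentiableAt_localCoord fun x hx => ?_
  have hs' := hs.mdifferentiableAt_localCoord hU hx
  have hw' := (isSmoothSection_iff.1 hw x).mdifferentiableAt (by simp)
  have hη' := (isSmoothSection_iff.1 hη x).mdifferentiableAt (by simp)
  have hd : dbarFun (localCoord η x) x = dbarFun (localCoord w x) x := by
    refine LinearMap.ext fun ξ => ?_
    rw [← coord_dbar, ← coord_dbar, h]
  have hηw : MDifferentiableAt 𝓘(ℂ, ℂ) 𝓘(ℂ, ℂ)
      (fun y => localCoord η x y + (-1) * localCoord w x y) x := by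
    have hm : MDifferentiableAt 𝓘(ℝ, ℂ) 𝓘(ℝ, ℂ) (fun y => (-1) * localCoord w x y) x :=
      mdifferentiableAt_const.mul hw'
    refine mdifferentiableAt_of_dbarFun_eq_zero (hη'.add hm) ?_
    rw [dbarFun_add hη' hm, dbarFun_mul mdifferentiableAt_const hw', hd, dbarFun_const]
    simp
  refine (hs'.add hηw).congr_of_eventuallyEq ?_
  filter_upwards [eventually_mem_baseSet E x] with y hy
  have e1 := coord_add hy (s y) (η y - w y)
  have e2 := ((trivializationAt ℂ E x).linear ℂ hy).map_sub (η y) (w y)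
  refine e1.trans ?_
  refine (congrArg _ e2).trans ?_
  simp only [Pi.add_apply, localCoord, TotalSpace.mk']
  ring

end Fibre

/-! ### Bounds for the metric in charts, and the volume measure -/

section Surface

variable {C : Type*} [TopologicalSpace C] [ChartedSpace ℂ C]

theorem HermitianMetric.exists_pos_le_normSq_localFrame {E : C → Type*}
    [∀ x, AddCommGroup (E x)] [∀ x, Module ℂ (E x)] [∀ x, TopologicalSpace (E x)]
    [TopologicalSpace (TotalSpace ℂ E)] [FiberBundle ℂ E] [VectorBundle ℂ ℂ E]
    (g : HermitianMetric E) (x₀ : C) :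
    ∃ m : ℝ, 0 < m ∧ ∀ᶠ y in 𝓝 x₀, m ≤ g.normSq y (localFrame E x₀ y) := by
  have hx := mem_baseSet_trivializationAt ℂ E x₀
  have hpos : 0 < g.normSq x₀ (localFrame E x₀ x₀) := g.normSq_pos (localFrame_ne_zero hx)
  refine ⟨g.normSq x₀ (localFrame E x₀ x₀) / 2, half_pos hpos, ?_⟩
  have hc := (g.continuousOn_normSq_localFrame x₀).continuousAt (eventually_mem_baseSet E x₀)
  filter_upwards [hc.eventually (lt_mem_nhds (half_lt_self hpos))] with y hy using hy.le

variable [IsManifold 𝓘(ℂ, ℂ) ω C]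

/-- The derivative at `y` of the preferred chart around `x₀`, with the tangent space at `y` read as
`ℂ`. -/
noncomputable def chartDeriv (x₀ y : C) : ℂ →L[ℂ] ℂ := mfderiv 𝓘(ℂ, ℂ) 𝓘(ℂ, ℂ) (chartAt ℂ x₀) y

/-- The coordinate of a tangent vector in the trivialization given by the chart at `x₀`. -/
theorem coord_tangent {x₀ y : C} (hy : y ∈ (chartAt ℂ x₀).source)
    (ξ : TangentSpace 𝓘(ℂ, ℂ) y) :
    (trivializationAt ℂ (TangentSpace 𝓘(ℂ, ℂ) : C → Type _) x₀ (TotalSpace.mk' ℂ y ξ)).2 =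
      chartDeriv x₀ y ξ := by
  have := isManifold_one C
  have h := TangentBundle.continuousLinearMapAt_trivializationAt (I := 𝓘(ℂ, ℂ)) hy
  have h1 := congrArg (fun L : ℂ →L[ℂ] ℂ => L ξ) h
  refine Eq.trans ?_ h1
  have hy' : y ∈ (trivializationAt ℂ (TangentSpace 𝓘(ℂ, ℂ) : C → Type _) x₀).baseSet := hy
  exact ((trivializationAt ℂ (TangentSpace 𝓘(ℂ, ℂ) : C → Type _) x₀).linearMapAt_apply
    (R := ℂ) ξ).trans (if_pos hy') |>.symm

/-- Near `x₀` the form `∂̄f` is dominated by the coordinate of the tangent vector, because the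
derivative of `f` in the chart at `x₀` is continuous. -/
theorem exists_norm_dbarFun_le {f : C → ℂ} (hf : ContMDiff 𝓘(ℝ, ℂ) 𝓘(ℝ, ℂ) ∞ f) (x₀ : C) :
    ∃ B : ℝ, ∀ᶠ y in 𝓝 x₀, ∀ ξ : TangentSpace 𝓘(ℂ, ℂ) y, ‖dbarFun f y ξ‖ ≤
      B * ‖chartDeriv x₀ y ξ‖ := by
  have := isManifold_one C
  set φ := chartAt ℂ x₀ with hφ
  set F : ℂ → ℂ := f ∘ φ.symm with hF
  have hFx : ContDiffAt ℝ ∞ F (φ x₀) := by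
    have h := (hf x₀).2
    exact h.contDiffAt (by simp)
  have hcont : ContinuousAt (fderiv ℝ F) (φ x₀) := by
    have : ContDiffAt ℝ 0 (fderiv ℝ F) (φ x₀) := hFx.fderiv_right (by simp)
    exact this.continuousAt
  have hdiff : ∀ᶠ z in 𝓝 (φ x₀), DifferentiableAt ℝ F z := by
    have h1 : ContDiffAt ℝ 1 F (φ x₀) := hFx.of_le (by simp)
    filter_upwards [h1.eventually (by simp)] with z hz using hz.differentiableAt (by simp)
  have hbd : ∀ᶠ z in 𝓝 (φ x₀), ‖fderiv ℝ F z‖ < ‖fderiv ℝ F (φ x₀)‖ + 1 :=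
    hcont.norm.eventually (gt_mem_nhds (lt_add_one _))
  have hφc : ContinuousAt φ x₀ := φ.continuousAt (mem_chart_source ℂ x₀)
  refine ⟨‖fderiv ℝ F (φ x₀)‖ + 1, ?_⟩
  filter_upwards [φ.open_source.mem_nhds (mem_chart_source ℂ x₀), hφc.eventually hdiff,
    hφc.eventually hbd] with y hy hyd hyb ξ
  set D : ℂ →L[ℂ] ℂ := chartDeriv x₀ y with hD
  have hφd : MDifferentiableAt 𝓘(ℂ, ℂ) 𝓘(ℂ, ℂ) φ y :=
    mdifferentiableAt_atlas (chart_mem_atlas ℂ x₀) hy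
  have hφr := hasMFDerivAt_restrictScalars hφd.hasMFDerivAt
  have hFr : HasMFDerivAt 𝓘(ℝ, ℂ) 𝓘(ℝ, ℂ) F (φ y) (fderiv ℝ F (φ y)) :=
    hyd.hasFDerivAt.hasMFDerivAt
  have hcomp := (hFr.comp y hφr).congr_of_eventuallyEq (f₁ := f) (by
    filter_upwards [φ.open_source.mem_nhds hy] with z hz
    simp only [hF, Function.comp_apply, φ.left_inv hz])
  have key : ∀ ζ : TangentSpace 𝓘(ℂ, ℂ) y, realDiff f y ζ = fderiv ℝ F (φ y) (D ζ) :=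
    fun ζ => realDiff_of_hasMFDerivAt hcomp ζ
  have hDI : D (Complex.I • ξ) = Complex.I * D ξ := D.map_smul Complex.I ξ
  have b1 := (fderiv ℝ F (φ y)).le_opNorm (D ξ)
  have b2 := (fderiv ℝ F (φ y)).le_opNorm (Complex.I * D ξ)
  rw [norm_mul, Complex.norm_I, one_mul] at b2
  have b3 := mul_le_mul_of_nonneg_right hyb.le (norm_nonneg (D ξ))
  rw [dbarFun_apply, key, key, hDI, norm_div]
  have b4 := norm_add_le (fderiv ℝ F (φ y) (D ξ))
    (Complex.I * fderiv ℝ F (φ y) (Complex.I * D ξ))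
  rw [norm_mul, Complex.norm_I, one_mul] at b4
  have e2 : ‖(2 : ℂ)‖ = 2 := by simp
  rw [e2, div_le_iff₀ two_pos]
  linarith

/-- On a compact surface the pointwise norm of `∂̄f` is bounded. -/
theorem exists_forall_norm_dbarFun_sq_le [CompactSpace C]
    (g : HermitianMetric (TangentSpace 𝓘(ℂ, ℂ) : C → Type _))
    {f : C → ℂ} (hf : ContMDiff 𝓘(ℝ, ℂ) 𝓘(ℝ, ℂ) ∞ f) :
    ∃ B : ℝ≥0, ∀ (y : C) (ξ : TangentSpace 𝓘(ℂ, ℂ) y), g.normSq y ξ ≤ 1 →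
      ‖dbarFun f y ξ‖ ^ 2 ≤ B := by
  suffices H : ∃ B : ℝ≥0, ∀ y ∈ (Set.univ : Set C), ∀ ξ : TangentSpace 𝓘(ℂ, ℂ) y,
      g.normSq y ξ ≤ 1 → ‖dbarFun f y ξ‖ ^ 2 ≤ B by
    obtain ⟨B, hB⟩ := H
    exact ⟨B, fun y => hB y (Set.mem_univ y)⟩
  refine isCompact_univ.induction_on (p := fun S : Set C => ∃ B : ℝ≥0, ∀ y ∈ S,
    ∀ ξ : TangentSpace 𝓘(ℂ, ℂ) y, g.normSq y ξ ≤ 1 → ‖dbarFun f y ξ‖ ^ 2 ≤ B) ?_ ?_ ?_ ?_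
  · exact ⟨0, fun y hy => hy.elim⟩
  · exact fun S T hST ⟨B, hB⟩ => ⟨B, fun y hy => hB y (hST hy)⟩
  · rintro S T ⟨B, hB⟩ ⟨B', hB'⟩
    refine ⟨max B B', fun y hy ξ hξ => ?_⟩
    rcases hy with hy | hy
    · exact (hB y hy ξ hξ).trans (NNReal.coe_le_coe.2 (le_max_left _ _))
    · exact (hB' y hy ξ hξ).trans (NNReal.coe_le_coe.2 (le_max_right _ _))
  · intro x₀ _
    obtain ⟨m, hm, hmy⟩ := g.exists_pos_le_normSq_localFrame x₀
    obtain ⟨B, hB⟩ := exists_norm_dbarFun_le hf x₀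
    have hsrc := (chartAt ℂ x₀).open_source.mem_nhds (mem_chart_source ℂ x₀)
    refine ⟨_, mem_nhdsWithin_of_mem_nhds (hmy.and (hB.and hsrc)), (B ^ 2 / m).toNNReal, ?_⟩
    rintro y ⟨hy1, hy2, hy3⟩ ξ hξ
    rw [Real.coe_toNNReal _ (by positivity), le_div_iff₀ hm]
    rw [g.normSq_eq (x₀ := x₀) hy3, coord_tangent hy3] at hξ
    have h1 := pow_le_pow_left₀ (norm_nonneg _) (hy2 ξ) 2
    set a := ‖chartDeriv x₀ y ξ‖
    have h2 : a ^ 2 * m ≤ 1 := (mul_le_mul_of_nonneg_left hy1 (sq_nonneg a)).trans hξ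
    calc _ ≤ (B * a) ^ 2 * m := by gcongr
      _ = B ^ 2 * (a ^ 2 * m) := by ring
      _ ≤ B ^ 2 * 1 := by gcongr
      _ = B ^ 2 := mul_one _

variable [MeasurableSpace C] [BorelSpace C]

/-- The volume measure charges every nonempty open set. -/
theorem isOpenPosMeasure_volumeMeasure
    (g : HermitianMetric (TangentSpace 𝓘(ℂ, ℂ) : C → Type _)) :
    (volumeMeasure g).IsOpenPosMeasure := by
  have := isManifold_one C
  refine ⟨fun U hU ⟨x₀, hx₀⟩ h0 => ?_⟩
  set φ := chartAt ℂ x₀ with hφ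
  have hle : chartVolume g φ ≤ volumeMeasure g :=
    le_iSup₂_of_le φ (IsManifold.chart_mem_maximalAtlas x₀) le_rfl
  have h1 : chartVolume g φ U = 0 := le_antisymm ((hle U).trans h0.le) zero_le
  have hae : AEMeasurable φ.symm (((volume : Measure ℂ).restrict φ.target).withDensity
      (fun z => ENNReal.ofReal (density g φ z))) :=
    (φ.continuousOn_symm.aemeasurable φ.open_target.measurableSet).mono_ac
      (withDensity_absolutelyContinuous _ _)
  obtain ⟨m, hm, hmy⟩ := g.exists_pos_le_normSq_localFrame x₀
  obtain ⟨V, hV, hVo, hxV⟩ := eventually_nhds_iff.1 hmy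
  -- the coordinate image of a neighbourhood on which the density is at least `m`
  set T : Set ℂ := φ.target ∩ φ.symm ⁻¹' (U ∩ V) with hT
  have hTo : IsOpen T := φ.isOpen_inter_preimage_symm (hU.inter hVo)
  have hTx : φ x₀ ∈ T := by
    refine ⟨φ.map_source (mem_chart_source ℂ x₀), ?_⟩
    rw [Set.mem_preimage, φ.left_inv (mem_chart_source ℂ x₀)]
    exact ⟨hx₀, hxV⟩
  have hdens : ∀ z ∈ T, m ≤ density g φ z := by
    intro z hz
    have hsrc : φ.symm z ∈ φ.source := φ.map_target hz.1
    have hs : MDifferentiableAt 𝓘(ℂ, ℂ) 𝓘(ℂ, ℂ) φ.symm z :=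
      mdifferentiableAt_atlas_symm (chart_mem_atlas ℂ x₀) hz.1
    have hd : MDifferentiableAt 𝓘(ℂ, ℂ) 𝓘(ℂ, ℂ) φ (φ.symm z) :=
      mdifferentiableAt_atlas (chart_mem_atlas ℂ x₀) hsrc
    have hc := hd.hasMFDerivAt.comp z hs.hasMFDerivAt
    have hid : HasMFDerivAt 𝓘(ℂ, ℂ) 𝓘(ℂ, ℂ) (φ ∘ φ.symm) z
        (ContinuousLinearMap.id ℂ (TangentSpace 𝓘(ℂ, ℂ) z)) := by
      refine (hasMFDerivAt_id z).congr_of_eventuallyEq ?_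
      filter_upwards [φ.open_target.mem_nhds hz.1] with w hw using φ.right_inv hw
    have h2 := congrArg (fun L : ℂ →L[ℂ] ℂ => L 1) (hasMFDerivAt_unique hc hid)
    have h3 : chartDeriv x₀ (φ.symm z)
        (mfderiv 𝓘(ℂ, ℂ) 𝓘(ℂ, ℂ) φ.symm z (1 : ℂ)) = (1 : ℂ) := h2
    rw [density, g.normSq_eq (x₀ := x₀) hsrc, coord_tangent hsrc, h3, norm_one, one_pow, one_mul]
    exact hV _ hz.2.2
  have h2 : ENNReal.ofReal m * volume T ≤ chartVolume g φ U := by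
    rw [chartVolume, Measure.map_apply_of_aemeasurable hae hU.measurableSet]
    calc ENNReal.ofReal m * volume T = ∫⁻ _ in T, ENNReal.ofReal m := by
          rw [setLIntegral_const]
      _ ≤ ∫⁻ z in T, ENNReal.ofReal (density g φ z) :=
          setLIntegral_mono' hTo.measurableSet fun z hz => ENNReal.ofReal_le_ofReal (hdens z hz)
      _ = ∫⁻ z in T, ENNReal.ofReal (density g φ z) ∂((volume : Measure ℂ).restrict φ.target) := by
          rw [Measure.restrict_restrict hTo.measurableSet,
            Set.inter_eq_self_of_subset_left (fun z hz => hz.1)]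
      _ = (((volume : Measure ℂ).restrict φ.target).withDensity
            (fun z => ENNReal.ofReal (density g φ z))) T :=
          (withDensity_apply _ hTo.measurableSet).symm
      _ ≤ _ := measure_mono fun z hz => hz.2.1
  rw [h1] at h2
  have h3 : ENNReal.ofReal m * volume T ≠ 0 :=
    mul_ne_zero (by simpa using hm) (hTo.measure_pos volume ⟨_, hTx⟩).ne'
  exact h3 (le_antisymm h2 zero_le)

end Surface

/-! ### `L²`-estimates for cochains -/

namespace NestedCovering

variable {C : Type*} [TopologicalSpace C] [ChartedSpace ℂ C] {ι : Type*} (𝒰 : NestedCovering C ι)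

theorem isOpen_nest (r : ℝ) (j : ι) : IsOpen (𝒰.nest r j) :=
  (𝒰.chart j).isOpen_inter_preimage Metric.isOpen_ball

theorem nest_mono {r r' : ℝ} (h : r ≤ r') (j : ι) : 𝒰.nest r j ⊆ 𝒰.nest r' j :=
  fun _ hx => ⟨hx.1, Metric.ball_subset_ball h hx.2⟩

theorem exists_mem_nest {r : ℝ} (hr : r ∈ Set.Icc 𝒰.rStar 1) (x : C) : ∃ j, x ∈ 𝒰.nest r j :=
  Set.mem_iUnion.1 ((𝒰.covers r hr).ge (Set.mem_univ x))

/-- A partition of unity with supports in the smallest sets `U_j^{r_*}`; it serves all radii. -/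
theorem exists_partition [T2Space C] [CompactSpace C] [IsManifold 𝓘(ℂ, ℂ) ω C] [Fintype ι] :
    ∃ χ : ι → C → ℂ, (∀ k, ContMDiff 𝓘(ℝ, ℂ) 𝓘(ℝ, ℂ) ∞ (χ k)) ∧
      (∀ k, tsupport (χ k) ⊆ 𝒰.nest 𝒰.rStar k) ∧ (∀ y, ∑ k, χ k y = 1) ∧
      ∀ k y, ‖χ k y‖ ≤ 1 := by
  have hcov : (Set.univ : Set C) ⊆ ⋃ j, 𝒰.nest 𝒰.rStar j := fun x _ =>
    Set.mem_iUnion.2 (𝒰.exists_mem_nest ⟨le_rfl, 𝒰.rStar_lt_one.le⟩ x)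
  obtain ⟨ρ, hρ⟩ := SmoothPartitionOfUnity.exists_isSubordinate 𝓘(ℝ, ℂ) isClosed_univ
    (𝒰.nest 𝒰.rStar) (𝒰.isOpen_nest 𝒰.rStar) hcov
  refine ⟨fun k y => (ρ k y : ℂ), fun k => ?_, fun k => ?_, fun y => ?_, fun k y => ?_⟩
  · exact Complex.ofRealCLM.contDiff.contMDiff.comp (ρ k).contMDiff
  · refine (closure_mono fun y hy => ?_).trans (hρ k)
    simpa using hy
  · have h := ρ.sum_eq_one (Set.mem_univ y)
    rw [finsum_eq_sum_of_fintype] at h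
    beta_reduce
    exact_mod_cast h
  · rw [Complex.norm_real, Real.norm_of_nonneg (ρ.nonneg k y)]
    exact ρ.le_one k y

end NestedCovering

section Estimates

variable {C : Type*} [TopologicalSpace C] [ChartedSpace ℂ C]
  {E : C → Type*} [∀ x, AddCommGroup (E x)] [∀ x, Module ℂ (E x)]
  [∀ x, TopologicalSpace (E x)] [TopologicalSpace (TotalSpace ℂ E)]
  [FiberBundle ℂ E] [VectorBundle ℂ ℂ E] (h : HermitianMetric E)

/-- Cauchy-Schwarz for a combination of vectors; only vectors with nonzero coefficient have to be
bounded, so a `b k` where the corresponding component is undefined does no harm. -/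
theorem HermitianMetric.ofReal_normSq_sum_smul_le {κ : Type*} [Fintype κ] {x : C} {a : κ → ℂ}
    {B : ℝ≥0} (hB : ∀ k, ‖a k‖ ^ 2 ≤ B) {b : κ → E x} {N : κ → ℝ≥0∞}
    (hN : ∀ k, a k ≠ 0 → ENNReal.ofReal (h.normSq x (b k)) ≤ N k) :
    ENNReal.ofReal (h.normSq x (∑ k, a k • b k)) ≤ Fintype.card κ * B * ∑ k, N k := by
  calc _ ≤ ENNReal.ofReal (Fintype.card κ * ∑ k, h.normSq x (a k • b k)) :=
        ENNReal.ofReal_le_ofReal (h.normSq_sum_le x Finset.univ _)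
    _ = Fintype.card κ * ∑ k, ENNReal.ofReal (h.normSq x (a k • b k)) := by
        rw [ENNReal.ofReal_mul (Nat.cast_nonneg _), ENNReal.ofReal_natCast,
          ENNReal.ofReal_sum_of_nonneg fun k _ => h.normSq_nonneg _ _]
    _ ≤ Fintype.card κ * ∑ k, B * N k := by
        gcongr with k
        rw [h.normSq_smul, ENNReal.ofReal_mul (sq_nonneg _)]
        by_cases hk : a k = 0
        · simp [hk]
        · exact mul_le_mul' (ENNReal.ofReal_le_of_le_toReal (hB k)) (hN k hk)
    _ = _ := by rw [← Finset.mul_sum, mul_assoc]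

/-- The squared length of the section `s` over `A`, extended by zero. -/
noncomputable def localDensity (A : Set C) (s : ∀ x, E x) : C → ℝ≥0∞ :=
  A.indicator fun x => ENNReal.ofReal (h.normSq x (s x))

theorem aemeasurable_localDensity [MeasurableSpace C] [BorelSpace C] {A : Set C} (hA : IsOpen A) {s : ∀ x, E x}
    (hs : ContinuousOn (fun x => h.normSq x (s x)) A) (μ : Measure C) :
    AEMeasurable (localDensity h A s) μ :=
  (aemeasurable_indicator_iff hA.measurableSet).2
    (ENNReal.measurable_ofReal.comp_aemeasurable (hs.aemeasurable hA.measurableSet))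

variable [IsManifold 𝓘(ℂ, ℂ) ω C] [MeasurableSpace C]
  (g : HermitianMetric (TangentSpace 𝓘(ℂ, ℂ) : C → Type _))

theorem l2Norm_sq (A : Set C) (s : ∀ x, E x) :
    l2Norm g h A s ^ 2 = ∫⁻ x in A, ENNReal.ofReal (h.normSq x (s x)) ∂(volumeMeasure g) := by
  rw [l2Norm, ← ENNReal.rpow_natCast, ← ENNReal.rpow_mul]
  norm_num

theorem l2NormForm_sq (v : ZeroOneForm E) :
    l2NormForm g h v ^ 2 = ∫⁻ x, formNormSq g h v x ∂(volumeMeasure g) := by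
  rw [l2NormForm, ← ENNReal.rpow_natCast, ← ENNReal.rpow_mul]
  norm_num

theorem lintegral_localDensity [BorelSpace C] {A : Set C} (hA : IsOpen A) (s : ∀ x, E x) :
    ∫⁻ x, localDensity h A s x ∂(volumeMeasure g) = l2Norm g h A s ^ 2 := by
  rw [localDensity, lintegral_indicator hA.measurableSet, l2Norm_sq]

end Estimates

namespace NestedCovering

variable {C : Type*} [TopologicalSpace C] [ChartedSpace ℂ C] {ι : Type*} (𝒰 : NestedCovering C ι)
  {E : C → Type*} [∀ x, AddCommGroup (E x)] [∀ x, Module ℂ (E x)]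
  [∀ x, TopologicalSpace (E x)] [TopologicalSpace (TotalSpace ℂ E)]
  [FiberBundle ℂ E] [VectorBundle ℂ ℂ E]
  (h : HermitianMetric E)

theorem IsOneCoboundary.continuousOn_normSq {r : ℝ} {f : ι → ι → ∀ x, E x}
    (hf : 𝒰.IsOneCoboundary r f) (j k : ι) :
    ContinuousOn (fun x => h.normSq x (f j k x)) (𝒰.nest r j ∩ 𝒰.nest r k) := by
  obtain ⟨v, hv, hvf⟩ := hf
  have hU := (𝒰.isOpen_nest r j).inter (𝒰.isOpen_nest r k)
  have hs : IsHolomorphicOn (fun x => v k x - v j x) (𝒰.nest r j ∩ 𝒰.nest r k) :=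
    IsHolomorphicOn.sub hU ((hv k).mono Set.inter_subset_right) ((hv j).mono Set.inter_subset_left)
  refine ContinuousOn.congr (f := fun x => h.normSq x (v k x - v j x)) (fun x hx => ?_)
    fun x hx => by rw [hvf j k x hx]
  exact (h.continuousAt_normSq (hs.continuousAt hU hx)).continuousWithinAt

variable [IsManifold 𝓘(ℂ, ℂ) ω C] [MeasurableSpace C]
  (g : HermitianMetric (TangentSpace 𝓘(ℂ, ℂ) : C → Type _))

theorem l2Norm_le_norm₁ (r : ℝ) (f : ι → ι → ∀ x, E x) (j k : ι) :
    l2Norm g h (𝒰.nest r j ∩ 𝒰.nest r k) (f j k) ≤ 𝒰.norm₁ g h r f :=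
  le_iSup₂ (f := fun j k => l2Norm g h (𝒰.nest r j ∩ 𝒰.nest r k) (f j k)) j k

/-- A coboundary of norm zero vanishes, by continuity. -/
theorem IsOneCoboundary.eq_zero_of_norm₁_eq_zero [BorelSpace C] {r : ℝ} {f : ι → ι → ∀ x, E x}
    (hf : 𝒰.IsOneCoboundary r f) (h0 : 𝒰.norm₁ g h r f = 0) (j k : ι) :
    ∀ x ∈ 𝒰.nest r j ∩ 𝒰.nest r k, f j k x = 0 := by
  have := isOpenPosMeasure_volumeMeasure g
  have hU := (𝒰.isOpen_nest r j).inter (𝒰.isOpen_nest r k)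
  have hc := hf.continuousOn_normSq 𝒰 h j k
  have h1 : l2Norm g h (𝒰.nest r j ∩ 𝒰.nest r k) (f j k) ^ 2 = 0 := by
    rw [le_antisymm ((𝒰.l2Norm_le_norm₁ h g r f j k).trans h0.le) zero_le]
    simp
  have hm : AEMeasurable (fun x => ENNReal.ofReal (h.normSq x (f j k x)))
      ((volumeMeasure g).restrict (𝒰.nest r j ∩ 𝒰.nest r k)) :=
    ENNReal.measurable_ofReal.comp_aemeasurable (hc.aemeasurable hU.measurableSet)
  rw [l2Norm_sq, lintegral_eq_zero_iff' hm] at h1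
  have h2 : (fun x => ENNReal.ofReal (h.normSq x (f j k x)))
      =ᵐ[(volumeMeasure g).restrict (𝒰.nest r j ∩ 𝒰.nest r k)] fun _ => 0 := h1
  have h3 := Measure.eqOn_open_of_ae_eq h2 hU (ENNReal.continuous_ofReal.comp_continuousOn hc)
    continuousOn_const
  intro x hx
  by_contra hne
  exact absurd (ENNReal.ofReal_eq_zero.1 (h3 hx)) (not_le.2 (h.normSq_pos hne))

variable [BorelSpace C] [Fintype ι] [ContMDiffVectorBundle ω ℂ E 𝓘(ℂ, ℂ)]

/-- The `∂̄`-correction: with cut-off functions `χ` whose `∂̄` is bounded by `B`, a Hörmander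
constant `c` produces a primitive of any coboundary whose norm is controlled by `c`. -/
theorem exists_primitive_of_isHormanderConstant {r : ℝ} (hr : r ∈ Set.Icc 𝒰.rStar 1)
    {χ : ι → C → ℂ} (hχ : ∀ k, ContMDiff 𝓘(ℝ, ℂ) 𝓘(ℝ, ℂ) ∞ (χ k))
    (hsupp : ∀ k, tsupport (χ k) ⊆ 𝒰.nest 𝒰.rStar k) (hsum : ∀ y, ∑ k, χ k y = 1)
    (hχ1 : ∀ k y, ‖χ k y‖ ≤ 1) {B : ℝ≥0}
    (hB : ∀ k (y : C) (ξ : TangentSpace 𝓘(ℂ, ℂ) y), g.normSq y ξ ≤ 1 →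
      ‖dbarFun (χ k) y ξ‖ ^ 2 ≤ B)
    {c : ℝ≥0} (hc : IsHormanderConstant g h c) {f : ι → ι → ∀ x, E x}
    (hf : 𝒰.IsOneCoboundary r f) :
    ∃ u : ι → ∀ x, E x, 𝒰.IsZeroCochain r u ∧ 𝒰.CoboundaryEq r u f ∧
      ∀ j, l2Norm g h (𝒰.nest r j) (u j) ^ 2 ≤
        2 * ((Fintype.card ι : ℝ≥0∞) ^ 2 + c ^ 2 * (Fintype.card ι ^ 3 * B)) *
          𝒰.norm₁ g h r f ^ 2 := by
  have hcont := hf.continuousOn_normSq 𝒰 h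
  obtain ⟨v, hv, hvf⟩ := hf
  set n : ℝ≥0∞ := (Fintype.card ι : ℝ≥0∞) with hn
  set F := 𝒰.norm₁ g h r f with hF
  have hV : ∀ k, IsOpen (𝒰.nest r k) := 𝒰.isOpen_nest r
  have hsupp' : ∀ k, tsupport (χ k) ⊆ 𝒰.nest r k := fun k =>
    (hsupp k).trans (𝒰.nest_mono hr.1 k)
  set w : ∀ x, E x := glue χ v with hw
  have hws : IsSmoothSection w := isSmoothSection_glue hχ hV hsupp' hv
  obtain ⟨η, hηs, hηd, hηn⟩ := hc (dbar w) ⟨w, hws, rfl⟩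
  -- the squared lengths of the components of `f`
  let N : ι → ι → C → ℝ≥0∞ := fun j k => localDensity h (𝒰.nest r j ∩ 𝒰.nest r k) (f j k)
  have hNm : ∀ j k, AEMeasurable (N j k) (volumeMeasure g) := fun j k =>
    aemeasurable_localDensity h ((hV j).inter (hV k)) (hcont j k) _
  have hNint : ∀ j k, ∫⁻ x, N j k x ∂(volumeMeasure g) ≤ F ^ 2 := fun j k => by
    rw [lintegral_localDensity h g ((hV j).inter (hV k))]
    exact pow_le_pow_left' (𝒰.l2Norm_le_norm₁ h g r f j k) 2
  have hNsum : ∀ j, ∫⁻ x, ∑ k, N j k x ∂(volumeMeasure g) ≤ n * F ^ 2 := fun j => by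
    rw [lintegral_finsetSum' _ fun k _ => hNm j k]
    calc _ ≤ ∑ _k : ι, F ^ 2 := Finset.sum_le_sum fun k _ => hNint j k
      _ = _ := by rw [Finset.sum_const, nsmul_eq_mul, Finset.card_univ]
  have hNf : ∀ j k, ∀ x ∈ 𝒰.nest r j, x ∈ 𝒰.nest r k →
      ENNReal.ofReal (h.normSq x (v k x - v j x)) ≤ N j k x := fun j k x hj hk => by
    rw [← hvf j k x ⟨hj, hk⟩]
    have hx : x ∈ 𝒰.nest r j ∩ 𝒰.nest r k := ⟨hj, hk⟩
    exact (Set.indicator_of_mem hx fun x => ENNReal.ofReal (h.normSq x (f j k x))).ge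
  have hform : ∀ x, formNormSq g h (dbar w) x ≤ n * B * ∑ j, ∑ k, N j k x := fun x => by
    obtain ⟨j, hj⟩ := 𝒰.exists_mem_nest hr x
    refine iSup₂_le fun ξ hξ => ?_
    rw [dbar_glue_apply hχ hV hsupp' hv hsum x ξ (v j x)]
    refine (h.ofReal_normSq_sum_smul_le (fun k => hB k x ξ hξ) (N := fun k => N j k x)
      fun k hk => hNf j k x hj ?_).trans ?_
    · by_contra hxk
      have h0 : χ k =ᶠ[𝓝 x] fun _ => 0 :=
        notMem_tsupport_iff_eventuallyEq.1 fun hx => hxk (hsupp' k hx)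
      exact hk (by rw [dbarFun_congr h0, dbarFun_const, LinearMap.zero_apply])
    · refine mul_le_mul' le_rfl ?_
      exact Finset.single_le_sum (f := fun j => ∑ k, N j k x) (fun _ _ => zero_le)
        (Finset.mem_univ j)
  have hformint : l2NormForm g h (dbar w) ^ 2 ≤ n ^ 3 * B * F ^ 2 := by
    rw [l2NormForm_sq]
    calc _ ≤ ∫⁻ x, n * B * ∑ j, ∑ k, N j k x ∂(volumeMeasure g) := lintegral_mono hform
      _ = n * B * ∑ j, ∫⁻ x, ∑ k, N j k x ∂(volumeMeasure g) := by
          rw [lintegral_const_mul' _ _ (by finiteness), lintegral_finsetSum' _ fun j _ =>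
            Finset.aemeasurable_fun_sum _ fun k _ => hNm j k]
      _ ≤ n * B * ∑ _j : ι, n * F ^ 2 := by
          gcongr with j
          exact hNsum j
      _ = _ := by
          rw [Finset.sum_const, nsmul_eq_mul, Finset.card_univ, ← hn]
          ring
  have hηint : ∫⁻ x, ENNReal.ofReal (h.normSq x (η x)) ∂(volumeMeasure g) ≤
      c ^ 2 * (n ^ 3 * B * F ^ 2) := by
    rw [← setLIntegral_univ, ← l2Norm_sq]
    calc _ ≤ (c * l2NormForm g h (dbar w)) ^ 2 := pow_le_pow_left' hηn 2
      _ = c ^ 2 * l2NormForm g h (dbar w) ^ 2 := mul_pow _ _ _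
      _ ≤ _ := by gcongr
  refine ⟨fun j x => v j x + (η x - w x), fun j => ?_, fun j k x hx => ?_, fun j => ?_⟩
  · exact (hv j).sub_add_of_dbar_eq (hV j) hws hηs hηd
  · rw [hvf j k x hx]
    exact (add_sub_add_right_eq_sub _ _ _).symm
  · have hpt : ∀ x ∈ 𝒰.nest r j, ENNReal.ofReal (h.normSq x (v j x + (η x - w x))) ≤
        2 * (n * ∑ k, N j k x) + 2 * ENNReal.ofReal (h.normSq x (η x)) := fun x hj => by
      have hwx : w x - v j x = ∑ k, χ k x • (v k x - v j x) := by
        simp only [smul_sub, Finset.sum_sub_distrib, ← Finset.sum_smul, hsum, one_smul]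
        rfl
      have h1 : ENNReal.ofReal (h.normSq x (v j x - w x)) ≤ n * ∑ k, N j k x := by
        rw [h.normSq_sub_comm, hwx]
        have := h.ofReal_normSq_sum_smul_le (B := 1) (a := fun k => χ k x)
          (b := fun k => v k x - v j x) (N := fun k => N j k x)
          (fun k => by
            rw [NNReal.coe_one]
            exact pow_le_one₀ (norm_nonneg _) (hχ1 k x))
          fun k hk => hNf j k x hj (hsupp' k (subset_tsupport _ hk))
        simpa using this
      calc _ = ENNReal.ofReal (h.normSq x ((v j x - w x) + η x)) := by
            congr 2
            abel
        _ ≤ ENNReal.ofReal (2 * (h.normSq x (v j x - w x) + h.normSq x (η x))) :=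
            ENNReal.ofReal_le_ofReal (h.normSq_add_le x _ _)
        _ = 2 * ENNReal.ofReal (h.normSq x (v j x - w x)) +
              2 * ENNReal.ofReal (h.normSq x (η x)) := by
            rw [ENNReal.ofReal_mul two_pos.le, ENNReal.ofReal_add (h.normSq_nonneg _ _)
              (h.normSq_nonneg _ _), ENNReal.ofReal_ofNat, mul_add]
        _ ≤ _ := by gcongr
    rw [l2Norm_sq]
    calc _ ≤ ∫⁻ x in 𝒰.nest r j, (2 * (n * ∑ k, N j k x) +
            2 * ENNReal.ofReal (h.normSq x (η x))) ∂(volumeMeasure g) :=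
          setLIntegral_mono' (hV j).measurableSet hpt
      _ ≤ ∫⁻ x, (2 * (n * ∑ k, N j k x) +
            2 * ENNReal.ofReal (h.normSq x (η x))) ∂(volumeMeasure g) :=
          setLIntegral_le_lintegral _ _
      _ = 2 * (n * ∫⁻ x, ∑ k, N j k x ∂(volumeMeasure g)) +
            2 * ∫⁻ x, ENNReal.ofReal (h.normSq x (η x)) ∂(volumeMeasure g) := by
          rw [lintegral_add_left' (((Finset.aemeasurable_fun_sum _ fun k _ =>
            hNm j k).const_mul _).const_mul _), lintegral_const_mul' _ _ (by finiteness),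
            lintegral_const_mul' _ _ (by finiteness), lintegral_const_mul' _ _ (by finiteness)]
      _ ≤ 2 * (n * (n * F ^ 2)) + 2 * (c ^ 2 * (n ^ 3 * B * F ^ 2)) := by
          gcongr
          exact hNsum j
      _ = _ := by ring

end NestedCovering

end RiemannSurface

open RiemannSurface in
theorem mainTheorem8 {C : Type*} [TopologicalSpace C] [T2Space C] [CompactSpace C]
    [ConnectedSpace C] [ChartedSpace ℂ C] [IsManifold 𝓘(ℂ, ℂ) ω C]
    [MeasurableSpace C] [BorelSpace C]
    (g : RiemannSurface.HermitianMetric (TangentSpace 𝓘(ℂ, ℂ) : C → Type))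
    {ι : Type*} [Finite ι] (𝒰 : RiemannSurface.NestedCovering C ι) :
    ∃ α β : ℝ≥0, 0 < α ∧ 0 < β ∧
      ∀ (E : C → Type*) [∀ x, AddCommGroup (E x)] [∀ x, Module ℂ (E x)]
        [∀ x, TopologicalSpace (E x)] [TopologicalSpace (TotalSpace ℂ E)]
        [FiberBundle ℂ E] [VectorBundle ℂ ℂ E] [ContMDiffVectorBundle ω ℂ E 𝓘(ℂ, ℂ)]
        (h : RiemannSurface.HermitianMetric E),
      ∀ r ∈ Set.Icc 𝒰.rStar 1, ∀ f : ι → ι → ∀ x, E x, 𝒰.IsOneCoboundary r f →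
        ∃ u : ι → ∀ x, E x, 𝒰.IsZeroCochain r u ∧ 𝒰.CoboundaryEq r u f ∧
          𝒰.norm₀ g h r u ≤
            (α + β * RiemannSurface.hormanderConstant g h) * 𝒰.norm₁ g h r f := by
  have := Fintype.ofFinite ι
  obtain ⟨χ, hχ, hsupp, hsum, hχ1⟩ := 𝒰.exists_partition
  choose B₀ hB₀ using fun k => exists_forall_norm_dbarFun_sq_le g (hχ k)
  set B : ℝ≥0 := ∑ k, B₀ k
  have hB : ∀ k (y : C) (ξ : TangentSpace 𝓘(ℂ, ℂ) y), g.normSq y ξ ≤ 1 →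
      ‖dbarFun (χ k) y ξ‖ ^ 2 ≤ B := fun k y ξ hξ => (hB₀ k y ξ hξ).trans
    (NNReal.coe_le_coe.2 (Finset.single_le_sum (fun _ _ => zero_le) (Finset.mem_univ k)))
  set n : ℝ≥0 := (Fintype.card ι : ℝ≥0) with hn
  refine ⟨2 * n + 2 * n ^ 2 * (B + 1) + 1, 2 * n ^ 2 * (B + 1) + 1, by positivity, by positivity,
    fun E _ _ _ _ _ _ _ h r hr f hf => ?_⟩
  by_cases hK : hormanderConstant g h = ⊤
  · -- only a coboundary of norm zero matters, and it vanishes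
    by_cases h0 : 𝒰.norm₁ g h r f = 0
    · refine ⟨fun _ _ => 0, fun j => ?_, fun j k x hx => ?_, ?_⟩
      · refine isHolomorphicOn_of_mdifferentiableAt_localCoord fun x _ => ?_
        refine (mdifferentiableAt_const (c := (0 : ℂ))).congr_of_eventuallyEq ?_
        filter_upwards [eventually_mem_baseSet E x] with y hy using coord_zero hy
      · rw [hf.eq_zero_of_norm₁_eq_zero 𝒰 h g h0 j k x hx, sub_zero]
      · refine iSup_le fun j => ?_
        simp [l2Norm, h.normSq_zero]
    · obtain ⟨v, hv, hvf⟩ := hf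
      refine ⟨v, hv, hvf, ?_⟩
      rw [hK, ENNReal.mul_top (by positivity), add_top, ENNReal.top_mul h0]
      exact le_top
  · have hlt : hormanderConstant g h < hormanderConstant g h + 1 :=
      ENNReal.lt_add_right hK one_ne_zero
    obtain ⟨c, hc⟩ := iInf_lt_iff.1 (show (⨅ (c : ℝ≥0) (_ : 0 < c ∧ IsHormanderConstant g h c),
      (c : ℝ≥0∞)) < hormanderConstant g h + 1 from hlt)
    obtain ⟨⟨-, hcH⟩, hcK⟩ := iInf_lt_iff.1 hc
    obtain ⟨u, hu, huf, hun⟩ := 𝒰.exists_primitive_of_isHormanderConstant h g hr hχ hsupp hsum hχ1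
      hB hcH hf
    refine ⟨u, hu, huf, iSup_le fun j => ?_⟩
    -- the bound of `hun` is dominated by the square of an expression affine in `c`
    have hcoef : 2 * (n ^ 2 + c ^ 2 * (n ^ 3 * B)) ≤ (2 * n + 2 * c * n ^ 2 * (B + 1)) ^ 2 := by
      have hn34 : n ^ 3 ≤ n ^ 4 := by
        rw [hn]
        norm_cast
        rcases Nat.eq_zero_or_pos (Fintype.card ι) with h0 | h0
        · simp [h0]
        · exact Nat.pow_le_pow_right h0 (by norm_num)
      have hBB : B ≤ (B + 1) ^ 2 := by
        calc B ≤ (B ^ 2 + B + 1) + B := le_add_self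
          _ = (B + 1) ^ 2 := by ring
      calc _ ≤ 2 * (n ^ 2 + c ^ 2 * (n ^ 4 * (B + 1) ^ 2)) := by gcongr
        _ ≤ 2 * (n ^ 2 + c ^ 2 * (n ^ 4 * (B + 1) ^ 2)) + (2 * n ^ 2 +
            2 * c ^ 2 * n ^ 4 * (B + 1) ^ 2 + 8 * c * n ^ 3 * (B + 1)) := le_self_add
        _ = _ := by ring
    have h1 : l2Norm g h (𝒰.nest r j) (u j) ≤
        ((2 * n + 2 * c * n ^ 2 * (B + 1) : ℝ≥0) : ℝ≥0∞) * 𝒰.norm₁ g h r f := by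
      refine (ENNReal.pow_le_pow_left_iff two_ne_zero).1 ((hun j).trans ?_)
      rw [mul_pow]
      gcongr
      rw [show (Fintype.card ι : ℝ≥0∞) = (n : ℝ≥0∞) from (ENNReal.coe_natCast _).symm]
      exact_mod_cast hcoef
    refine h1.trans ?_
    gcongr
    push_cast
    calc _ ≤ 2 * (n : ℝ≥0∞) + 2 * (hormanderConstant g h + 1) * n ^ 2 * (B + 1) := by gcongr
      _ = 2 * n + 2 * n ^ 2 * (B + 1) + 2 * n ^ 2 * (B + 1) * hormanderConstant g h := by ring
      _ ≤ _ := by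
        gcongr ?_ + ?_ * _
        · exact le_self_add
        · exact le_self_add
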